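/- **Setting.** Let $X=(T,W)$ be a random vector with treatments $T=(X_1,\dots,X_J)$ and controls $W=(X_{J+1},\dots,X_{J+L})$, taking values in $\mathcal X\subseteq\mathbb R^{J}\times\mathbb R^{L}$, and let $U\in\mathcal U$, $V\in\mathcal V$ be unobserved random elements of standard Borel spaces (all on a standard Borel probability space). The latent variable is $H=h(X,U)$, where $h$ is measurable and maps $\mathcal X\times\mathcal U$ into $\mathcal H\subseteq\mathbb R$, and the report is $R=r(H,V)$, where $r$ is measurable and maps $\mathcal H\times\mathcal V$ into $\mathcal R\subseteq\mathbb R$. For $v\in\mathcal V$ and $r\in\mathcal R$ put $\tau_v(r)=\sup\{y\in\mathcal H: r(y,v)\le r\}\in[-\infty,\infty]$. Fix versions of the conditional laws of $V$ given $W=w$ and of $U$ given $(W,V)=(w,v)$. For $x=(t,w)$, probabilities and expectations given $X=x$ are those under which $v$ is drawn from the law of $V$ given $W=w$ and then $u$ from the law of $U$ given $(W,V)=(w,v)$; those given $(x,v)$ are under the law of $U$ given $(w,v)$ (with $H=h(x,U)$). Fix $j\in\{1,\dots,J\}$, and let $\mathcal X^{\circ}$ be the set of $x\in\mathcal X$ such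 that $\mathcal X$ contains every point obtained from $x$ by a sufficiently small change of $x_j$ in either direction. **HONEST.** For every $v\in\mathcal V$, $r(\cdot,v)$ is weakly increasing and left-continuous on $\mathcal H$. **EXOG.** $T$ is independent of $V$ conditionally on $W$, and $T$ is independent of $U$ conditionally on $(W,V)$. **REG.** (i) The law of $X_j$ is absolutely continuous. For all $x\in\mathcal X^\circ$, $v\in\mathcal V$: (ii) $\partial_{x_j}h(x,u)$ exists for all $u\in\mathcal U$; (iii) given $(x,v)$, $H$ has a density $f(\cdot|x,v)$ with respect to Lebesgue measure; (iv) for all $\alpha\in(0,1)$ the derivative $\partial_{x_j}Q_{H|XV}(\alpha|x,v)$ of the conditional quantile function exists and is at most a constant $M<\infty$ not depending on $(\alpha,x,v)$; (v) given $(x,v)$, the pair $(H,\partial_{x_j}h(x,U))$ has a measurable joint density $f(y,d|x,v)\ge 0$ with respect to $dy\otimes\nu(dd)$, where $\nu$ is a fixed $\sigma$-finite measure on $\mathbb R$ (for instance Lebesgue measure, or a point mass when the effect is homogeneous), and $f(y,d|x,v)\le c(d)$ for all $y,d,x,v$, with $\int c(d)|d|\,\nu(dd)<\infty$. Here $f(y|x,v)=\int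 f(y,d|x,v)\,\nu(dd)$, and $\mathbb E[\partial_{x_j}h(x,U)\mid H=y,x,v]=\int d\,\frac{f(y,d|x,v)}{f(y|x,v)}\,\nu(dd)$. **Theorem.** Assume HONEST, EXOG and REG for $j$. Then the conditional laws given $X=x$ described above form a regular conditional distribution of $(V,U)$ given $X$, and, for every $r\in\mathcal R$, $x\mapsto P(R\le r\mid X=x)$ is a version of the conditional probability of $\{R\le r\}$ given $X$. Let moreover $x\in\mathcal X^\circ$ be such that, for almost every $v$ (under the law of $V$ given $X=x$) with $\tau_v(r)$ finite, $f(\tau_v(r)|x,v)<\infty$ and, for $\nu$-almost every $d$, the joint density $f(y,d|x,v)$ is continuous in $(x_j,y)$ at $y=\tau_v(r)$ and the given $x$. Then $P(R\le r\mid X=x)$ is differentiable in $x_j$ at $x$, and $$\partial_{x_j}P(R\le r\mid X=x)=-\mathbb E\Big\{f(\tau_V(r)\mid x,V)\cdot\mathbb E\big[\partial_{x_j}h(x,U)\mid H=\tau_V(r),x,V\big]\,\Big|\,X=x\Big\},$$ where the outer expectation is over $V$, its integrand is integrable, and the integrand is read as $0$ where $\tau_V(r)=\pm\infty$ or where $f(\tau_V(r)|x,V)=0$.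 -/

import Mathlib

open MeasureTheory ProbabilityTheory Filter Topology

noncomputable section

namespace OrderedResponse

/-- A value `x = (t, w)` of the regressors: `J` treatments `t` and `L` controls `w`. -/
abbrev Regressor (J L : ℕ) := (Fin J → ℝ) × (Fin L → ℝ)

variable {J L : ℕ} {𝒱 𝒰 Ω : Type*} [MeasurableSpace 𝒱] [MeasurableSpace 𝒰]

/-- `x` with its `j`-th treatment component replaced by `s`. -/
def setComp (x : Regressor J L) (j : Fin J) (s : ℝ) : Regressor J L :=
  (Function.update x.1 j s, x.2)

/-- Points of `𝒳` at which `x_j` can be varied a little in both directions within `𝒳`. -/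
def compInterior (𝒳 : Set (Regressor J L)) (j : Fin J) : Set (Regressor J L) :=
  {x | ∀ᶠ s in 𝓝 (x.1 j), setComp x j s ∈ 𝒳}

/-- The partial derivative `∂_{x_j} h(x, u)`. -/
def partialX (j : Fin J) (h : Regressor J L → 𝒰 → ℝ) (x : Regressor J L) (u : 𝒰) : ℝ :=
  deriv (fun s => h (setComp x j s) u) (x.1 j)

/-- HONEST: on the set `ℋ` of latent values, every reporting function `r(·, v)` is weakly
increasing and left-continuous. -/
def Honest (ℋ : Set ℝ) (r : ℝ → 𝒱 → ℝ) : Prop :=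
  ∀ v, MonotoneOn (fun y => r y v) ℋ ∧
    ∀ y ∈ ℋ, ContinuousWithinAt (fun y' => r y' v) (ℋ ∩ Set.Iio y) y

/-- The threshold `τ_v(r₀) = sup {y ∈ ℋ : r(y, v) ≤ r₀}`, as an extended real. -/
def threshold (ℋ : Set ℝ) (r : ℝ → 𝒱 → ℝ) (v : 𝒱) (r₀ : ℝ) : EReal :=
  sSup ((fun y : ℝ => (y : EReal)) '' {y ∈ ℋ | r y v ≤ r₀})

/-- EXOG: given the controls `W`, the treatments are independent of `V`; given `(W, V)`, they are
independent of `U`. -/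
def Exog [MeasurableSpace Ω] [StandardBorelSpace Ω] (P : Measure Ω) [IsFiniteMeasure P]
    (T : Ω → Fin J → ℝ) (W : Ω → Fin L → ℝ) (V : Ω → 𝒱) (U : Ω → 𝒰)
    (hW : Measurable W) (hV : Measurable V) : Prop :=
  CondIndepFun (MeasurableSpace.comap W inferInstance) hW.comap_le T V P ∧
  CondIndepFun (MeasurableSpace.comap (fun ω => (W ω, V ω)) inferInstance)
    (hW.prodMk hV).comap_le T U P

/-- The conditional law of `(V, U)` given `X = (t, w)` obtained by drawing `v` from the conditional
law of `V` given `W = w`, and then `u` from the conditional law of `U` given `(W, V) = (w, v)`. -/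
def condLaw (κV : Kernel (Fin L → ℝ) 𝒱) (κU : Kernel ((Fin L → ℝ) × 𝒱) 𝒰) :
    Kernel (Regressor J L) (𝒱 × 𝒰) :=
  (κV.comap Prod.snd measurable_snd) ⊗ₖ
    (κU.comap (fun q : Regressor J L × 𝒱 => (q.1.2, q.2)) (by fun_prop))

/-- `P(R ≤ r₀ | X = x)`, where `R = r(h(X, U), V)`. -/
def reportCDF (κV : Kernel (Fin L → ℝ) 𝒱) (κU : Kernel ((Fin L → ℝ) × 𝒱) 𝒰)
    (h : Regressor J L → 𝒰 → ℝ) (r : ℝ → 𝒱 → ℝ) (r₀ : ℝ) (x : Regressor J L) : ℝ :=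
  (condLaw κV κU x).real {q | r (h x q.2) q.1 ≤ r₀}

/-- The conditional quantile function `Q_{H|XV}(α | x, v)`. -/
def condQuantile (κU : Kernel ((Fin L → ℝ) × 𝒱) 𝒰) (h : Regressor J L → 𝒰 → ℝ)
    (α : ℝ) (x : Regressor J L) (v : 𝒱) : ℝ :=
  sInf {y : ℝ | α ≤ (κU (x.2, v)).real {u | h x u ≤ y}}

/-- The conditional density `f(y | x, v)` of `H`, as the marginal of the joint density
`p x v y d` of `(H, ∂_{x_j} h)` given `(x, v)`; here `ν` is the reference measure for `d`. -/
def condDensity (ν : Measure ℝ) (p : Regressor J L → 𝒱 → ℝ → ℝ → ℝ)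
    (x : Regressor J L) (v : 𝒱) (y : ℝ) : ℝ :=
  ∫ d, p x v y d ∂ν

/-- `E[∂_{x_j} h(x, U) | H = y, x, v]`: the mean of the conditional density `p x v y d / f(y | x, v)`
of `∂_{x_j} h(x, U)` given `H = y`. -/
def condEffect (ν : Measure ℝ) (p : Regressor J L → 𝒱 → ℝ → ℝ → ℝ)
    (x : Regressor J L) (v : 𝒱) (y : ℝ) : ℝ :=
  ∫ d, d * (p x v y d / condDensity ν p x v y) ∂ν

open Classical in
/-- `f(τ | x, v) · E[∂_{x_j} h(x, U) | H = τ, x, v]` at an extended real `τ`; the density vanishes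
at `±∞`. -/
def flow (ν : Measure ℝ) (p : Regressor J L → 𝒱 → ℝ → ℝ → ℝ)
    (x : Regressor J L) (v : 𝒱) (τ : EReal) : ℝ :=
  if τ = ⊤ ∨ τ = ⊥ then 0
  else condDensity ν p x v τ.toReal * condEffect ν p x v τ.toReal

/-- REG for the component `j`, with `p x v` the joint density of `(H, ∂_{x_j} h)` given `X = x`,
`V = v` with respect to `volume.prod ν`. -/
structure Reg [MeasurableSpace Ω] (P : Measure Ω) (T : Ω → Fin J → ℝ)
    (κU : Kernel ((Fin L → ℝ) × 𝒱) 𝒰) (h : Regressor J L → 𝒰 → ℝ)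
    (𝒳 : Set (Regressor J L)) (j : Fin J) (ν : Measure ℝ)
    (p : Regressor J L → 𝒱 → ℝ → ℝ → ℝ) : Prop where
  /-- `X_j` is continuously distributed. -/
  treatment_ac : P.map (fun ω => T ω j) ≪ volume
  /-- `∂_{x_j} h` exists. -/
  differentiable : ∀ x ∈ compInterior 𝒳 j, ∀ u,
    DifferentiableAt ℝ (fun s => h (setComp x j s) u) (x.1 j)
  /-- `H` is continuously distributed given `X` and `V`, with density `f(· | x, v)`. -/
  latent_density : ∀ x ∈ compInterior 𝒳 j, ∀ v, (κU (x.2, v)).map (h x) =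
    volume.withDensity (fun y => ENNReal.ofReal (condDensity ν p x v y))
  /-- The conditional quantile function of `H` has a bounded partial derivative. -/
  quantile : ∃ M : ℝ, ∀ x ∈ compInterior 𝒳 j, ∀ v, ∀ α ∈ Set.Ioo (0 : ℝ) 1,
    DifferentiableAt ℝ (fun s => condQuantile κU h α (setComp x j s) v) (x.1 j) ∧
    deriv (fun s => condQuantile κU h α (setComp x j s) v) (x.1 j) ≤ M
  joint_measurable : ∀ x ∈ compInterior 𝒳 j, ∀ v,
    Measurable (fun q : ℝ × ℝ => p x v q.1 q.2)
  joint_nonneg : ∀ x ∈ compInterior 𝒳 j, ∀ v y d, 0 ≤ p x v y d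
  /-- `p x v` is the density of `(H, ∂_{x_j} h)` given `X = x`, `V = v`. -/
  joint_density : ∀ x ∈ compInterior 𝒳 j, ∀ v,
    (κU (x.2, v)).map (fun u => (h x u, partialX j h x u)) =
      (volume.prod ν).withDensity (fun q => ENNReal.ofReal (p x v q.1 q.2))
  /-- The joint density is dominated by some `c(h')` with `∫ c(h') |h'| dh' < ∞`. -/
  joint_bound : ∃ c : ℝ → ℝ, Integrable (fun d => c d * |d|) ν ∧
    ∀ x ∈ compInterior 𝒳 j, ∀ v y d, p x v y d ≤ c d

/-- The densities are genuinely defined at the point `y`: the density of `H` is finite there, and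
the joint density is continuous in `(x_j, h)` at `(x_j, y)`. -/
def RegularAt (j : Fin J) (ν : Measure ℝ) (p : Regressor J L → 𝒱 → ℝ → ℝ → ℝ)
    (x : Regressor J L) (v : 𝒱) (y : ℝ) : Prop :=
  Integrable (p x v y) ν ∧
  ∀ᵐ d ∂ν, ContinuousAt (fun q : ℝ × ℝ => p (setComp x j q.1) v q.2 d) (x.1 j, y)

end OrderedResponse

end

open OrderedResponse

/-! Monotonicity and left-continuity turn `r (h x u) v ≤ r₀` into `h x u ≤ τ`, with `τ` the
threshold of `v` (`Honest.le_iff_le_threshold`). By EXOG the laws of `V` and of `U` given `V` depend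
on `x` only through the controls, so moving `x_j` changes the event and not the measure. It remains
to differentiate `P(h(x,U) ≤ τ)` in `x_j` for fixed `v`, and then to integrate over `v`.

For fixed `v`, write `t` for `x_j`, `g t u` for the latent value and `q t y d` for the joint density
of `g t` and its `t`-derivative. The flow of mass through the level `y` is `m(t,y) = ∫ d, d * q t y
d ∂ν`. Replacing the indicator of `(-∞, τ]` by a smooth cutoff with derivative `-k`, the fundamental
theorem along each path and Fubini give an increment of `-∫ t in a..b, ∫ y, k y * m(t,y)`
(`integral_comp_sub`). Letting `k` concentrate just above `τ` yields `abs_cdf_sub_add_le`: if `m` is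
within `K` of `A` near `τ`, the increment of the distribution function is within `K (b - a)` of `-A
(b - a)`.

This estimate is used twice. With `A = 0` and `K = ∫ c(d)|d|` it gives a Lipschitz bound uniform in
`v`; with `A = m(t₀,τ)` and `K` arbitrarily small, by continuity of `m`, it gives the derivative
`-m(t₀,τ)`. The Lipschitz bound then allows differentiation under the integral over `v`. -/

namespace ProbabilityTheory

/-! ### Conditional laws: composition and conditional independence. -/

section CondDistrib

variable {Ω α β γ : Type*} [MeasurableSpace Ω] [MeasurableSpace α] [MeasurableSpace β]
  [MeasurableSpace γ] {P : Measure Ω}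

lemma HasCondDistrib.compProd [SFinite P] {X : Ω → α} {Y : Ω → β} {Z : Ω → γ}
    {κ : Kernel α β} [IsMarkovKernel κ] {η : Kernel (α × β) γ} [IsMarkovKernel η]
    (hY : HasCondDistrib Y X κ P) (hZ : HasCondDistrib Z (fun ω => (X ω, Y ω)) η P) :
    HasCondDistrib (fun ω => (Y ω, Z ω)) X (κ ⊗ₖ η) P := by
  have h1 : AEMeasurable X P := hY.aemeasurable_fst
  have h2 : AEMeasurable Y P := hY.aemeasurable_snd
  have h3 : AEMeasurable Z P := hZ.aemeasurable_snd
  refine ⟨by fun_prop, ?_⟩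
  calc P.map (fun ω => (X ω, Y ω, Z ω))
      = (P.map (fun ω => ((X ω, Y ω), Z ω))).map MeasurableEquiv.prodAssoc := by
        rw [AEMeasurable.map_map_of_aemeasurable (by fun_prop) (by fun_prop)]
        rfl
    _ = (P.map X ⊗ₘ κ ⊗ₘ η).map MeasurableEquiv.prodAssoc := by rw [hZ.map_eq, hY.map_eq]
    _ = P.map X ⊗ₘ (κ ⊗ₖ η) := by
        rw [← Measure.compProd_assoc, Measure.map_map (by fun_prop) (by fun_prop)]
        simp

/-- Conditional independence says that the additional conditioning variable `Z` carries no
information on `Y` beyond `X`. The a.e. equality with the chosen version `κ` is pulled back along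
the projection from the law of `(X, Z)` to that of `X`. -/
lemma HasCondDistrib.prodMkRight_of_condIndepFun [StandardBorelSpace Ω] [IsProbabilityMeasure P]
    [StandardBorelSpace β] [StandardBorelSpace γ] {X : Ω → α} {Y : Ω → β} {Z : Ω → γ}
    (hX : Measurable X) (hY : Measurable Y) (hZ : Measurable Z)
    {κ : Kernel α β} [IsMarkovKernel κ] (hκ : HasCondDistrib Y X κ P)
    (hind : CondIndepFun (MeasurableSpace.comap X inferInstance) hX.comap_le Z Y P) :
    HasCondDistrib Y (fun ω => (X ω, Z ω)) (κ.prodMkRight γ) P := by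
  have : Nonempty Ω := nonempty_of_isProbabilityMeasure P
  have : Nonempty β := ‹Nonempty Ω›.map Y
  have : Nonempty γ := ‹Nonempty Ω›.map Z
  have h1 := (condIndepFun_iff_condDistrib_prod_ae_eq_prodMkRight hY hZ hX).1 hind
  have h2 : condDistrib Y X P =ᵐ[P.map X] κ :=
    (condDistrib_ae_eq_iff_measure_eq_compProd X hY.aemeasurable κ).2 hκ.map_eq
  refine ⟨by fun_prop, ?_⟩
  refine (condDistrib_ae_eq_iff_measure_eq_compProd (fun ω => (X ω, Z ω)) hY.aemeasurable _).1 ?_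
  refine h1.trans ?_
  have h3 : (P.map (fun ω => (X ω, Z ω))).map Prod.fst = P.map X := by
    rw [Measure.map_map (by fun_prop) (by fun_prop)]; rfl
  rw [← h3] at h2
  filter_upwards [ae_of_ae_map (by fun_prop) h2] with a ha
  simpa using ha

lemma HasCondDistrib.condExp_indicator_ae_eq [StandardBorelSpace β] [IsProbabilityMeasure P]
    {X : Ω → α} {Y : Ω → β} (hX : Measurable X) (hY : Measurable Y)
    {κ : Kernel α β} [IsMarkovKernel κ] (hκ : HasCondDistrib Y X κ P)
    {S : Set (α × β)} (hS : MeasurableSet S) :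
    P⟦{ω | (X ω, Y ω) ∈ S} | MeasurableSpace.comap X inferInstance⟧
      =ᵐ[P] fun ω => (κ (X ω)).real {b | (X ω, b) ∈ S} := by
  have : Nonempty Ω := nonempty_of_isProbabilityMeasure P
  have : Nonempty β := ‹Nonempty Ω›.map Y
  have h2 : condDistrib Y X P =ᵐ[P.map X] κ :=
    (condDistrib_ae_eq_iff_measure_eq_compProd X hY.aemeasurable κ).2 hκ.map_eq
  have h3 := condExp_prod_ae_eq_integral_condDistrib (μ := P) (X := X) (Y := Y)
    (f := S.indicator (fun _ => (1 : ℝ))) hX hY.aemeasurable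
    (stronglyMeasurable_const.indicator hS)
    ((integrable_const (1 : ℝ)).indicator (hX.prodMk hY hS))
  refine Filter.EventuallyEq.trans (Eventually.of_forall fun ω => rfl) (h3.trans ?_)
  filter_upwards [ae_of_ae_map hX.aemeasurable h2] with ω hω
  rw [hω]
  have h4 : MeasurableSet {b | (X ω, b) ∈ S} := measurable_prodMk_left hS
  rw [← integral_indicator_one h4]
  rfl

end CondDistrib

end ProbabilityTheory

namespace OrderedResponse

variable {J L : ℕ} {𝒱 𝒰 Ω : Type*} [MeasurableSpace 𝒱] [MeasurableSpace 𝒰]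

instance (κV : Kernel (Fin L → ℝ) 𝒱) [IsMarkovKernel κV]
    (κU : Kernel ((Fin L → ℝ) × 𝒱) 𝒰) [IsMarkovKernel κU] :
    IsMarkovKernel (condLaw (J := J) κV κU) := by
  unfold condLaw; infer_instance

lemma hasCondDistrib_condLaw [MeasurableSpace Ω] [StandardBorelSpace Ω]
    [StandardBorelSpace 𝒱] [StandardBorelSpace 𝒰] {P : Measure Ω} [IsProbabilityMeasure P]
    {T : Ω → Fin J → ℝ} {W : Ω → Fin L → ℝ} {V : Ω → 𝒱} {U : Ω → 𝒰}
    (hT : Measurable T) (hW : Measurable W) (hV : Measurable V) (hU : Measurable U)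
    (κV : Kernel (Fin L → ℝ) 𝒱) [IsMarkovKernel κV]
    (κU : Kernel ((Fin L → ℝ) × 𝒱) 𝒰) [IsMarkovKernel κU]
    (hκV : HasCondDistrib V W κV P)
    (hκU : HasCondDistrib U (fun ω => (W ω, V ω)) κU P) (exog : Exog P T W V U hW hV) :
    HasCondDistrib (fun ω => (V ω, U ω)) (fun ω => (T ω, W ω)) (condLaw κV κU) P := by
  refine HasCondDistrib.compProd ?_ ?_
  · exact (hκV.prodMkRight_of_condIndepFun hW hV hT exog.1).measurableEquiv_comp_right
      MeasurableEquiv.prodComm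
  · let e : ((Fin L → ℝ) × 𝒱) × (Fin J → ℝ) ≃ᵐ ((Fin J → ℝ) × (Fin L → ℝ)) × 𝒱 :=
      MeasurableEquiv.prodComm.trans MeasurableEquiv.prodAssoc.symm
    exact (hκU.prodMkRight_of_condIndepFun (hW.prodMk hV) hU hT
      exog.2).measurableEquiv_comp_right e

lemma condExp_report_ae_eq [MeasurableSpace Ω] [StandardBorelSpace Ω]
    [StandardBorelSpace 𝒱] [StandardBorelSpace 𝒰] {P : Measure Ω} [IsProbabilityMeasure P]
    {X : Ω → Regressor J L} {V : Ω → 𝒱} {U : Ω → 𝒰}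
    (hX : Measurable X) (hV : Measurable V) (hU : Measurable U)
    (κV : Kernel (Fin L → ℝ) 𝒱) [IsMarkovKernel κV]
    (κU : Kernel ((Fin L → ℝ) × 𝒱) 𝒰) [IsMarkovKernel κU]
    (hlaw : HasCondDistrib (fun ω => (V ω, U ω)) X (condLaw κV κU) P)
    {h : Regressor J L → 𝒰 → ℝ} (hh : Measurable (Function.uncurry h))
    {r : ℝ → 𝒱 → ℝ} (hr : Measurable (Function.uncurry r)) (r₀ : ℝ) :
    P⟦{ω | r (h (X ω) (U ω)) (V ω) ≤ r₀} | MeasurableSpace.comap X inferInstance⟧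
        =ᵐ[P] fun ω => reportCDF κV κU h r r₀ (X ω) := by
  have hm : Measurable fun z : Regressor J L × 𝒱 × 𝒰 => r (h z.1 z.2.2) z.2.1 :=
    hr.comp ((hh.comp (measurable_fst.prodMk (measurable_snd.comp measurable_snd))).prodMk
      (measurable_fst.comp measurable_snd))
  exact hlaw.condExp_indicator_ae_eq hX (hV.prodMk hU)
    (S := {z | r (h z.1 z.2.2) z.2.1 ≤ r₀}) (measurableSet_le hm measurable_const)

end OrderedResponse

/-! ### Flow of mass through a level, for a one-parameter family. -/

namespace OrderedResponse

/-- Smooth cutoffs `φ` decreasing from `1` on `(-∞, τ]` to `0` on `[τ + ε, ∞)`. -/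
lemma exists_smooth_cutoff (τ : ℝ) {ε : ℝ} (hε : 0 < ε) :
    ∃ φ k : ℝ → ℝ, (∀ y, HasDerivAt φ (-k y) y) ∧ Continuous k ∧ Integrable k ∧ (∫ y, k y) = 1 ∧
      (∀ y, 0 ≤ k y) ∧ (∀ y, k y ≠ 0 → y ∈ Set.Icc τ (τ + ε)) ∧ (∀ y, φ y ∈ Set.Icc (0 : ℝ) 1) ∧
      (∀ y ≤ τ, φ y = 1) ∧ ∀ y, τ + ε ≤ y → φ y = 0 := by
  let σ : ℝ → ℝ := fun y => Real.smoothTransition (ε⁻¹ * (y - τ))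
  have hσc : ContDiff ℝ 1 σ := by
    have : ContDiff ℝ 1 Real.smoothTransition := Real.smoothTransition.contDiff (n := 1)
    exact this.comp (contDiff_const.mul (contDiff_id.sub contDiff_const))
  have hmono : Monotone σ := fun a b hab =>
    Real.smoothTransition.monotone (by gcongr)
  have h0 : ∀ y ≤ τ, σ y = 0 := fun y hy =>
    Real.smoothTransition.zero_of_nonpos
      (mul_nonpos_of_nonneg_of_nonpos (by positivity) (by linarith))
  have h1 : ∀ y, τ + ε ≤ y → σ y = 1 := fun y hy => by
    apply Real.smoothTransition.one_of_one_le
    rw [inv_mul_eq_div, le_div_iff₀ hε]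
    linarith
  have hder : ∀ y, HasDerivAt σ (deriv σ y) y := fun y =>
    ((hσc.differentiable (by norm_num)) y).hasDerivAt
  have hk : Continuous (deriv σ) := hσc.continuous_deriv le_rfl
  have hsupp : ∀ y, deriv σ y ≠ 0 → y ∈ Set.Icc τ (τ + ε) := by
    intro y hy
    by_contra hcon
    apply hy
    rw [Set.mem_Icc, not_and_or, not_le, not_le] at hcon
    rcases hcon with hlt | hlt
    · have : σ =ᶠ[𝓝 y] fun _ => 0 := by
        filter_upwards [Iio_mem_nhds hlt] with z hz using h0 z (le_of_lt hz)
      rw [this.deriv_eq, deriv_const]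
    · have : σ =ᶠ[𝓝 y] fun _ => 1 := by
        filter_upwards [Ioi_mem_nhds hlt] with z hz using h1 z (le_of_lt hz)
      rw [this.deriv_eq, deriv_const]
  have hint : Integrable (deriv σ) :=
    hk.integrable_of_hasCompactSupport
      (HasCompactSupport.of_support_subset_isCompact isCompact_Icc fun y hy => hsupp y hy)
  refine ⟨fun y => 1 - σ y, deriv σ, fun y => ?_, hk, hint, ?_, fun y => hmono.deriv_nonneg,
    hsupp, fun y => ?_, fun y hy => ?_, fun y hy => ?_⟩
  · simpa using (hder y).const_sub 1
  · have := integral_of_hasDerivAt_of_tendsto (m := 0) (n := 1) hder hint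
      (tendsto_const_nhds.congr' ?_) (tendsto_const_nhds.congr' ?_)
    · simpa using this
    · filter_upwards [eventually_le_atBot τ] with y hy using (h0 y hy).symm
    · filter_upwards [eventually_ge_atTop (τ + ε)] with y hy using (h1 y hy).symm
  · exact ⟨sub_nonneg.2 (Real.smoothTransition.le_one _),
      sub_le_self _ (Real.smoothTransition.nonneg _)⟩
  · simp [h0 y hy]
  · simp [h1 y hy]

variable {𝒰 : Type*} [MeasurableSpace 𝒰]

/-- A family of random variables `g t`, differentiable in the parameter `t ∈ I`, such that
`(g t, ∂ₜ g t)` has a joint density `q t` with respect to `volume.prod ν`, dominated by `c`. -/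
structure HasJointFlowDensity (μ : Measure 𝒰) (g : ℝ → 𝒰 → ℝ) (I : Set ℝ) (ν : Measure ℝ)
    (q : ℝ → ℝ → ℝ → ℝ) (c : ℝ → ℝ) : Prop where
  measurable : Measurable (Function.uncurry g)
  isOpen : IsOpen I
  differentiableAt : ∀ t ∈ I, ∀ u, DifferentiableAt ℝ (fun s => g s u) t
  density_measurable : ∀ t ∈ I, Measurable fun z : ℝ × ℝ => q t z.1 z.2
  density_nonneg : ∀ t ∈ I, ∀ y d, 0 ≤ q t y d
  density_le : ∀ t ∈ I, ∀ y d, q t y d ≤ c d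
  integrable_bound : Integrable (fun d => c d * |d|) ν
  map_eq : ∀ t ∈ I, μ.map (fun u => (g t u, deriv (fun s => g s u) t)) =
    (volume.prod ν).withDensity fun z => ENNReal.ofReal (q t z.1 z.2)

namespace HasJointFlowDensity

variable {μ : Measure 𝒰} {g : ℝ → 𝒰 → ℝ} {I : Set ℝ} {ν : Measure ℝ} {q : ℝ → ℝ → ℝ → ℝ}
  {c : ℝ → ℝ}

/-- A pointwise limit of measurable difference quotients. Fubini in `(t, u)` needs joint
measurability; the indicator is there because differentiability is known only on `I`. -/
lemma measurable_indicator_deriv (hg : HasJointFlowDensity μ g I ν q c) :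
    Measurable fun z : ℝ × 𝒰 => I.indicator (fun t => deriv (fun s => g s z.2) t) z.1 := by
  have hlim : Tendsto (fun n : ℕ => (fun z : ℝ × 𝒰 => I.indicator (fun t =>
      ((1 : ℝ) / (n + 1))⁻¹ * (g (t + 1 / (n + 1)) z.2 - g t z.2)) z.1)) atTop
      (𝓝 fun z : ℝ × 𝒰 => I.indicator (fun t => deriv (fun s => g s z.2) t) z.1) := by
    rw [tendsto_pi_nhds]
    rintro ⟨t, u⟩
    by_cases ht : t ∈ I
    · simp only [Set.indicator_of_mem ht]
      have h0 : Tendsto (fun n : ℕ => (1 : ℝ) / (n + 1)) atTop (𝓝[≠] 0) :=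
        tendsto_nhdsWithin_iff.2 ⟨tendsto_one_div_add_atTop_nhds_zero_nat,
          Eventually.of_forall fun n => by
            simp only [Set.mem_compl_iff, Set.mem_singleton_iff]
            positivity⟩
      exact (hg.differentiableAt t ht u).hasDerivAt.tendsto_slope_zero.comp h0
    · simp only [Set.indicator_of_notMem ht]
      exact tendsto_const_nhds
  refine measurable_of_tendsto_metrizable (fun n => ?_) hlim
  have h1 : Measurable fun z : ℝ × 𝒰 =>
      ((1 : ℝ) / (n + 1))⁻¹ * (g (z.1 + 1 / (n + 1)) z.2 - g z.1 z.2) :=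
    (((hg.measurable.comp ((measurable_fst.add_const _).prodMk measurable_snd)).sub
      hg.measurable).const_mul _)
  exact h1.indicator (hg.isOpen.measurableSet.preimage measurable_fst)

lemma measurable_deriv (hg : HasJointFlowDensity μ g I ν q c) {t : ℝ} (ht : t ∈ I) :
    Measurable fun u => deriv (fun s => g s u) t := by
  have := hg.measurable_indicator_deriv.comp (measurable_prodMk_left (x := t))
  simpa [Function.comp_def, Set.indicator_of_mem ht] using this

lemma measurable_apply (hg : HasJointFlowDensity μ g I ν q c) (t : ℝ) : Measurable (g t) :=
  hg.measurable.comp measurable_prodMk_left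

lemma integral_comp (hg : HasJointFlowDensity μ g I ν q c) {t : ℝ} (ht : t ∈ I) {ψ : ℝ × ℝ → ℝ}
    (hψ : Measurable ψ) :
    ∫ u, ψ (g t u, deriv (fun s => g s u) t) ∂μ = ∫ z, q t z.1 z.2 * ψ z ∂(volume.prod ν) := by
  rw [← integral_map (φ := fun u => (g t u, deriv (fun s => g s u) t))
    ((hg.measurable_apply t).prodMk (hg.measurable_deriv ht)).aemeasurable
    hψ.aestronglyMeasurable, hg.map_eq t ht, integral_withDensity_eq_integral_toReal_smul
      (hg.density_measurable t ht).ennreal_ofReal (by simp)]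
  simp [ENNReal.toReal_ofReal (hg.density_nonneg t ht _ _)]

lemma integrable_comp_iff (hg : HasJointFlowDensity μ g I ν q c) {t : ℝ} (ht : t ∈ I)
    {ψ : ℝ × ℝ → ℝ} (hψ : Measurable ψ) :
    Integrable (fun u => ψ (g t u, deriv (fun s => g s u) t)) μ ↔
      Integrable (fun z => q t z.1 z.2 * ψ z) (volume.prod ν) := by
  have h1 := integrable_map_measure (f := fun u => (g t u, deriv (fun s => g s u) t)) (g := ψ)
    (μ := μ) hψ.aestronglyMeasurable
    ((hg.measurable_apply t).prodMk (hg.measurable_deriv ht)).aemeasurable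
  rw [hg.map_eq t ht, integrable_withDensity_iff_integrable_smul'
    (hg.density_measurable t ht).ennreal_ofReal (by simp)] at h1
  simpa [ENNReal.toReal_ofReal (hg.density_nonneg t ht _ _), Function.comp_def] using h1.symm

/-- The dominating function is the product of `|k y|` and `c d * |d|`, each integrable in its own
variable. -/
lemma integrable_density_mul (hg : HasJointFlowDensity μ g I ν q c) {t : ℝ} (ht : t ∈ I)
    {k : ℝ → ℝ} (hk : Measurable k) (hki : Integrable k) :
    Integrable (fun z : ℝ × ℝ => q t z.1 z.2 * (k z.1 * z.2)) (volume.prod ν) := by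
  refine (hki.abs.mul_prod hg.integrable_bound).mono'
    ((hg.density_measurable t ht).mul
      ((hk.comp measurable_fst).mul measurable_snd)).aestronglyMeasurable
    (Eventually.of_forall fun z => ?_)
  rw [Real.norm_eq_abs, abs_mul, abs_mul, abs_of_nonneg (hg.density_nonneg t ht _ _)]
  have := mul_le_mul_of_nonneg_right (hg.density_le t ht z.1 z.2)
    (mul_nonneg (abs_nonneg (k z.1)) (abs_nonneg z.2))
  linarith

lemma abs_integral_mul_density_le (hg : HasJointFlowDensity μ g I ν q c) {t : ℝ} (ht : t ∈ I)
    (y : ℝ) : |∫ d, d * q t y d ∂ν| ≤ ∫ d, c d * |d| ∂ν := by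
  refine norm_integral_le_of_norm_le (f := fun d => d * q t y d) hg.integrable_bound
    (Eventually.of_forall fun d => ?_)
  rw [Real.norm_eq_abs, abs_mul, abs_of_nonneg (hg.density_nonneg t ht y d), mul_comm]
  exact mul_le_mul_of_nonneg_right (hg.density_le t ht y d) (abs_nonneg d)

variable [SigmaFinite ν]

/-- The bound is free of `t`, which gives integrability over a bounded interval of parameters times
`𝒰`. -/
lemma integral_norm_le (hg : HasJointFlowDensity μ g I ν q c) {t : ℝ} (ht : t ∈ I)
    {k : ℝ → ℝ} (hk : Measurable k) (hki : Integrable k) :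
    ∫ u, ‖k (g t u) * deriv (fun s => g s u) t‖ ∂μ ≤ (∫ y, |k y|) * ∫ d, c d * |d| ∂ν := by
  rw [hg.integral_comp ht (ψ := fun z => ‖k z.1 * z.2‖) (by fun_prop), ← integral_prod_mul]
  refine integral_mono ?_ (hki.abs.mul_prod hg.integrable_bound) fun z => ?_
  · refine (hg.integrable_density_mul ht hk hki).norm.congr (Eventually.of_forall fun z => ?_)
    simp only [norm_mul, Real.norm_of_nonneg (hg.density_nonneg t ht _ _)]
  · simp only [Real.norm_eq_abs, abs_mul]
    have := mul_le_mul_of_nonneg_right (hg.density_le t ht z.1 z.2)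
      (mul_nonneg (abs_nonneg (k z.1)) (abs_nonneg z.2))
    linarith

/-- The flow of mass per unit of `t` through the level `y`. -/
lemma integral_mul_deriv (hg : HasJointFlowDensity μ g I ν q c) {t : ℝ} (ht : t ∈ I)
    {k : ℝ → ℝ} (hk : Measurable k) (hki : Integrable k) :
    Integrable (fun y => k y * ∫ d, d * q t y d ∂ν) ∧
    ∫ u, k (g t u) * deriv (fun s => g s u) t ∂μ = ∫ y, k y * ∫ d, d * q t y d ∂ν := by
  have hi := hg.integrable_density_mul ht hk hki
  have hrw : ∀ y, ∫ d, q t y d * (k y * d) ∂ν = k y * ∫ d, d * q t y d ∂ν := fun y => by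
    rw [← integral_const_mul]
    congr with d
    ring
  constructor
  · simpa only [hrw] using hi.integral_prod_left
  · rw [hg.integral_comp ht (ψ := fun z => k z.1 * z.2) (by fun_prop), integral_prod _ hi]
    simp only [hrw]

/-- The fundamental theorem of calculus in mean. -/
lemma integral_comp_sub (hg : HasJointFlowDensity μ g I ν q c) [IsProbabilityMeasure μ]
    {φ k : ℝ → ℝ} (hφ : ∀ y, HasDerivAt φ (k y) y) (hb : ∀ y, φ y ∈ Set.Icc (0 : ℝ) 1)
    (hk : Continuous k) (hki : Integrable k) {a b : ℝ} (hab : a ≤ b) (hI : Set.Icc a b ⊆ I) :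
    IntervalIntegrable (fun t => ∫ y, k y * ∫ d, d * q t y d ∂ν) volume a b ∧
    (∫ u, φ (g b u) ∂μ) - ∫ u, φ (g a u) ∂μ =
      ∫ t in a..b, ∫ y, k y * ∫ d, d * q t y d ∂ν := by
  have hIoc : Set.uIoc a b ⊆ I := by
    rw [Set.uIoc_of_le hab]; exact Set.Ioc_subset_Icc_self.trans hI
  have hφm : Measurable φ := (continuous_iff_continuousAt.2 fun y => (hφ y).continuousAt).measurable
  have hφi : ∀ t, Integrable (fun u => φ (g t u)) μ := fun t =>
    Integrable.of_bound (hφm.comp (hg.measurable_apply t)).aestronglyMeasurable 1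
      (Eventually.of_forall fun u => by
        rw [Real.norm_of_nonneg (hb _).1]; exact (hb _).2)
  let D : ℝ → 𝒰 → ℝ := fun t u => I.indicator (fun t => deriv (fun s => g s u) t) t
  have hD : ∀ t ∈ I, ∀ u, D t u = deriv (fun s => g s u) t := fun t ht u =>
    Set.indicator_of_mem ht _
  have hjm : Measurable (Function.uncurry fun t u => k (g t u) * D t u) :=
    (hk.measurable.comp hg.measurable).mul hg.measurable_indicator_deriv
  have hint : Integrable (Function.uncurry fun t u => k (g t u) * D t u)
      ((volume.restrict (Set.uIoc a b)).prod μ) := by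
    rw [integrable_prod_iff hjm.aestronglyMeasurable]
    constructor
    · refine (ae_restrict_iff' measurableSet_uIoc).2 (Eventually.of_forall fun t ht => ?_)
      simp only [Function.uncurry_apply_pair, hD t (hIoc ht)]
      exact (hg.integrable_comp_iff (hIoc ht) (ψ := fun z => k z.1 * z.2) (by fun_prop)).2
        (hg.integrable_density_mul (hIoc ht) hk.measurable hki)
    · have : IsFiniteMeasure (volume.restrict (Set.uIoc a b)) := by
        rw [Set.uIoc_of_le hab]; infer_instance
      refine Integrable.of_bound hjm.aestronglyMeasurable.norm.integral_prod_right'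
        ((∫ y, |k y|) * ∫ d, c d * |d| ∂ν)
        ((ae_restrict_iff' measurableSet_uIoc).2 (Eventually.of_forall fun t ht => ?_))
      rw [Real.norm_of_nonneg (integral_nonneg fun u => norm_nonneg _)]
      simp only [Function.uncurry_apply_pair, hD t (hIoc ht)]
      exact hg.integral_norm_le (hIoc ht) hk.measurable hki
  have heq : ∀ t ∈ I, ∫ u, k (g t u) * D t u ∂μ = ∫ y, k y * ∫ d, d * q t y d ∂ν :=
    fun t ht => by
      simp only [hD t ht]
      exact (hg.integral_mul_deriv ht hk.measurable hki).2
  -- No measurability of `q` in `t` is assumed; that of the flow integral comes from its form as an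
  -- integral over `u`.
  refine ⟨intervalIntegrable_iff.2 (hint.integral_prod_left.congr
    ((ae_restrict_iff' measurableSet_uIoc).2 (Eventually.of_forall fun t ht =>
      heq t (hIoc ht)))), ?_⟩
  calc (∫ u, φ (g b u) ∂μ) - ∫ u, φ (g a u) ∂μ
      = ∫ u, (φ (g b u) - φ (g a u)) ∂μ := (integral_sub (hφi b) (hφi a)).symm
    _ = ∫ u, (∫ t in a..b, k (g t u) * D t u) ∂μ := by
        refine integral_congr_ae ?_
        -- The derivative along a path need not be continuous, so the fundamental theorem needs its
        -- integrability, which holds for almost every `u`.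
        filter_upwards [hint.prod_left_ae] with u hu
        refine (intervalIntegral.integral_eq_sub_of_hasDerivAt (f := fun t => φ (g t u))
          (fun t ht => ?_) (intervalIntegrable_iff.2 hu)).symm
        rw [Set.uIcc_of_le hab] at ht
        simp only [Function.uncurry_apply_pair, hD t (hI ht)]
        exact (hφ _).comp t (hg.differentiableAt t (hI ht) u).hasDerivAt
    _ = ∫ t in a..b, ∫ u, k (g t u) * D t u ∂μ := (intervalIntegral_integral_swap hint).symm
    _ = ∫ t in a..b, ∫ y, k y * ∫ d, d * q t y d ∂ν := by
        refine intervalIntegral.integral_congr fun t ht => ?_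
        rw [Set.uIcc_of_le hab] at ht
        exact heq t (hI ht)

/-- If the flow density stays within `K` of `A` near the level `τ`, then the distribution function
at `τ` changes by `-A (b - a)` up to `K (b - a)`. -/
lemma abs_cdf_sub_add_le (hg : HasJointFlowDensity μ g I ν q c) [IsProbabilityMeasure μ]
    {a b : ℝ} (hab : a ≤ b) (hI : Set.Icc a b ⊆ I) {τ A K ε : ℝ} (hε : 0 < ε)
    (hK : ∀ t ∈ Set.Icc a b, ∀ y ∈ Set.Icc τ (τ + ε), |(∫ d, d * q t y d ∂ν) - A| ≤ K) :
    |μ.real {u | g b u ≤ τ} - μ.real {u | g a u ≤ τ} + A * (b - a)| ≤ K * (b - a) := by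
  -- The transition lies to the right of `τ`, so that the cutoffs converge to the indicator of the
  -- closed half-line at every point, `τ` included. The widths `ε / (n + 1)` keep every `k n`
  -- supported in `[τ, τ + ε]`.
  choose φ k hφ hkc hki hk1 hk0 hks hφb hφ1 hφ0 using fun n : ℕ =>
    exists_smooth_cutoff τ (ε := ε / (n + 1)) (by positivity)
  have hlim : ∀ t, Tendsto (fun n => ∫ u, φ n (g t u) ∂μ) atTop (𝓝 (μ.real {u | g t u ≤ τ})) := by
    intro t
    have hm : MeasurableSet {u | g t u ≤ τ} :=
      measurableSet_le (hg.measurable_apply t) measurable_const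
    rw [← integral_indicator_one hm]
    refine tendsto_integral_of_dominated_convergence (fun _ => 1) (fun n => ?_)
      (integrable_const 1) (fun n => Eventually.of_forall fun u => ?_)
      (Eventually.of_forall fun u => ?_)
    · exact ((continuous_iff_continuousAt.2 fun y => (hφ n y).continuousAt).measurable.comp
        (hg.measurable_apply t)).aestronglyMeasurable
    · rw [Real.norm_of_nonneg (hφb n _).1]; exact (hφb n _).2
    · by_cases hu : g t u ≤ τ
      · simp [hu, hφ1 _ _ hu]
      · have h0 : Tendsto (fun n : ℕ => τ + ε / (n + 1)) atTop (𝓝 τ) := by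
          simpa [div_eq_mul_inv] using
            ((tendsto_one_div_add_atTop_nhds_zero_nat (𝕜 := ℝ)).const_mul ε).const_add τ
        refine tendsto_const_nhds.congr' ?_
        filter_upwards [h0.eventually_lt_const (not_le.1 hu)] with n hn
        simp [hu, hφ0 n _ hn.le]
  refine le_of_tendsto ((((hlim b).sub (hlim a)).add_const (A * (b - a))).abs)
    (Eventually.of_forall fun n => ?_)
  have hsub : ∀ y, k n y ≠ 0 → y ∈ Set.Icc τ (τ + ε) := fun y hy =>
    ⟨(hks n y hy).1, (hks n y hy).2.trans (by
      gcongr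
      exact div_le_self hε.le (by linarith [n.cast_nonneg (α := ℝ)]))⟩
  obtain ⟨hii, hsub_eq⟩ := hg.integral_comp_sub (hφ n) (hφb n) (hkc n).neg (hki n).neg hab hI
  rw [hsub_eq]
  -- Since `k n` is a probability density, the inner integral is minus an average of the flow over
  -- levels where it is within `K` of `A`.
  have hpt : ∀ t ∈ Set.Icc a b, |(∫ y, -k n y * ∫ d, d * q t y d ∂ν) + A| ≤ K := by
    intro t ht
    have h1 := (hg.integral_mul_deriv (hI ht) (hkc n).measurable (hki n)).1
    have h2 : (∫ y, -k n y * ∫ d, d * q t y d ∂ν) + A =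
        -∫ y, k n y * ((∫ d, d * q t y d ∂ν) - A) := by
      simp only [mul_sub, neg_mul]
      rw [integral_sub h1 ((hki n).mul_const A), integral_mul_const, hk1, integral_neg]
      ring
    rw [h2, abs_neg]
    refine (abs_integral_le_integral_abs).trans ?_
    calc ∫ y, |k n y * ((∫ d, d * q t y d ∂ν) - A)|
        ≤ ∫ y, k n y * K := by
          refine integral_mono ?_ ((hki n).mul_const K) fun y => ?_
          · refine Integrable.abs ?_
            simp only [mul_sub]
            exact h1.sub ((hki n).mul_const A)
          · simp only [abs_mul, abs_of_nonneg (hk0 n y)]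
            by_cases hy : k n y = 0
            · simp [hy]
            · exact mul_le_mul_of_nonneg_left (hK t ht y (hsub y hy)) (hk0 n y)
      _ = K := by rw [integral_mul_const, hk1, one_mul]
  have h3 : (∫ t in a..b, ∫ y, -k n y * ∫ d, d * q t y d ∂ν) + A * (b - a) =
      ∫ t in a..b, ((∫ y, -k n y * ∫ d, d * q t y d ∂ν) + A) := by
    rw [intervalIntegral.integral_add hii intervalIntegrable_const,
      intervalIntegral.integral_const, smul_eq_mul, mul_comm A]
  rw [h3]
  have h4 := intervalIntegral.norm_integral_le_of_norm_le_const (a := a) (b := b) (C := K)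
    (f := fun t => (∫ y, -k n y * ∫ d, d * q t y d ∂ν) + A) fun t ht => by
      rw [Set.uIoc_of_le hab] at ht
      exact hpt t (Set.Ioc_subset_Icc_self ht)
  rwa [Real.norm_eq_abs, abs_of_nonneg (sub_nonneg.2 hab)] at h4

/-- The case `A = 0` of `abs_cdf_sub_add_le`, the flow being bounded everywhere by `∫ c(d)|d|`; no
continuity of the density is needed. -/
lemma lipschitzOnWith_cdf (hg : HasJointFlowDensity μ g I ν q c) [IsProbabilityMeasure μ]
    (hI : I.OrdConnected) (τ : ℝ) :
    LipschitzOnWith (Real.nnabs (∫ d, c d * |d| ∂ν)) (fun t => μ.real {u | g t u ≤ τ}) I := by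
  have key : ∀ a ∈ I, ∀ b ∈ I, a ≤ b →
      |μ.real {u | g b u ≤ τ} - μ.real {u | g a u ≤ τ}| ≤ |∫ d, c d * |d| ∂ν| * |b - a| := by
    intro a ha b hb hab
    have hsub := hI.out ha hb
    have := hg.abs_cdf_sub_add_le hab hsub (τ := τ) (A := 0) one_pos
      fun t ht y _ => by
        rw [sub_zero]; exact (hg.abs_integral_mul_density_le (hsub ht) y).trans (le_abs_self _)
    rwa [zero_mul, add_zero, ← abs_of_nonneg (sub_nonneg.2 hab)] at this
  refine LipschitzOnWith.of_dist_le_mul fun a ha b hb => ?_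
  rw [Real.coe_nnabs, Real.dist_eq, Real.dist_eq]
  rcases le_total a b with hab | hab
  · rw [abs_sub_comm, abs_sub_comm a b]; exact key a ha b hb hab
  · exact key b hb a ha hab

lemma hasDerivAt_cdf (hg : HasJointFlowDensity μ g I ν q c) [IsProbabilityMeasure μ]
    (hI : I.OrdConnected) {t₀ τ : ℝ} (ht₀ : t₀ ∈ I)
    (hq : ∀ᵐ d ∂ν, ContinuousAt (fun z : ℝ × ℝ => q z.1 z.2 d) (t₀, τ)) :
    HasDerivAt (fun t => μ.real {u | g t u ≤ τ}) (-∫ d, d * q t₀ τ d ∂ν) t₀ := by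
  have hIn : ∀ᶠ z : ℝ × ℝ in 𝓝 (t₀, τ), z.1 ∈ I :=
    continuous_fst.continuousAt.eventually_mem (hg.isOpen.mem_nhds ht₀)
  -- Continuity for almost every `d` passes to the flow by dominated convergence, with bound `c d *
  -- |d|`.
  have hcont : ContinuousAt (fun z : ℝ × ℝ => ∫ d, d * q z.1 z.2 d ∂ν) (t₀, τ) := by
    refine continuousAt_of_dominated (bound := fun d => c d * |d|) ?_ ?_ hg.integrable_bound ?_
    · filter_upwards [hIn] with z hz
      exact (measurable_id.mul
        ((hg.density_measurable _ hz).comp measurable_prodMk_left)).aestronglyMeasurable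
    · filter_upwards [hIn] with z hz
      refine Eventually.of_forall fun d => ?_
      rw [Real.norm_eq_abs, abs_mul, abs_of_nonneg (hg.density_nonneg _ hz _ d), mul_comm]
      exact mul_le_mul_of_nonneg_right (hg.density_le _ hz _ d) (abs_nonneg d)
    · filter_upwards [hq] with d hd using continuousAt_const.mul hd
  rw [hasDerivAt_iff_isLittleO, Asymptotics.isLittleO_iff]
  intro η hη
  obtain ⟨δ, hδ, hball⟩ := Metric.eventually_nhds_iff.1
    ((Metric.continuousAt_iff'.1 hcont η hη).and hIn)
  set A := ∫ d, d * q t₀ τ d ∂ν with hA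
  have hnear : ∀ t, |t - t₀| < δ → ∀ y ∈ Set.Icc τ (τ + δ / 2),
      |(∫ d, d * q t y d ∂ν) - A| ≤ η := by
    intro t ht y hy
    have hd : dist (t, y) (t₀, τ) < δ := by
      rw [Prod.dist_eq, max_lt_iff, Real.dist_eq, Real.dist_eq, abs_of_nonneg (sub_nonneg.2 hy.1)]
      exact ⟨ht, by linarith [hy.2]⟩
    have := (hball hd).1.le
    rwa [Real.dist_eq] at this
  filter_upwards [Metric.ball_mem_nhds t₀ hδ] with t ht
  rw [Metric.mem_ball, Real.dist_eq] at ht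
  have hmem : t ∈ I := (hball (y := (t, τ)) (by
    rw [Prod.dist_eq, dist_self, Real.dist_eq]; exact max_lt ht hδ)).2
  rw [Real.norm_eq_abs, Real.norm_eq_abs, smul_eq_mul]
  rcases le_total t₀ t with hle | hle
  · have := hg.abs_cdf_sub_add_le hle (hI.out ht₀ hmem) (τ := τ) (half_pos hδ)
      fun s hs => hnear s (by
        rw [abs_of_nonneg (sub_nonneg.2 hs.1)]
        rw [abs_of_nonneg (sub_nonneg.2 hle)] at ht
        linarith [hs.2])
    rw [abs_of_nonneg (sub_nonneg.2 hle)]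
    convert this using 2
    ring
  · have := hg.abs_cdf_sub_add_le hle (hI.out hmem ht₀) (τ := τ) (half_pos hδ)
      fun s hs => hnear s (by
        rw [abs_sub_comm, abs_of_nonneg (sub_nonneg.2 hs.2)]
        rw [abs_sub_comm, abs_of_nonneg (sub_nonneg.2 hle)] at ht
        linarith [hs.1])
    rw [abs_sub_comm t, abs_of_nonneg (sub_nonneg.2 hle), ← abs_neg]
    convert this using 2
    ring

end HasJointFlowDensity

end OrderedResponse

/-! ### Thresholds, and integration over the reporting heterogeneity. -/

namespace OrderedResponse

variable {J L : ℕ} {𝒱 𝒰 Ω : Type*}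

@[simp]
lemma setComp_setComp (x : Regressor J L) (j : Fin J) (s t : ℝ) :
    setComp (setComp x j s) j t = setComp x j t := by
  simp [setComp]

@[simp]
lemma setComp_fst_self (x : Regressor J L) (j : Fin J) (s : ℝ) : (setComp x j s).1 j = s := by
  simp [setComp]

@[simp]
lemma setComp_self (x : Regressor J L) (j : Fin J) : setComp x j (x.1 j) = x := by
  simp [setComp]

lemma measurable_setComp (x : Regressor J L) (j : Fin J) :
    Measurable (setComp x j) :=
  (measurable_update x.1).prodMk measurable_const

lemma partialX_setComp (j : Fin J) (h : Regressor J L → 𝒰 → ℝ) (x : Regressor J L) (t : ℝ)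
    (u : 𝒰) : partialX j h (setComp x j t) u = deriv (fun s => h (setComp x j s) u) t := by
  simp [partialX]

lemma eventually_setComp_mem_compInterior {𝒳 : Set (Regressor J L)} {j : Fin J}
    {x : Regressor J L} (hx : x ∈ compInterior 𝒳 j) :
    ∀ᶠ s in 𝓝 (x.1 j), setComp x j s ∈ compInterior 𝒳 j := by
  have h1 : ∀ᶠ s in 𝓝 (x.1 j), setComp x j s ∈ 𝒳 := hx
  filter_upwards [h1.eventually_nhds] with s hs
  simpa [compInterior] using hs

lemma mem_of_mem_compInterior {𝒳 : Set (Regressor J L)} {j : Fin J} {x : Regressor J L}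
    (hx : x ∈ compInterior 𝒳 j) : x ∈ 𝒳 := by
  have h1 : ∀ᶠ s in 𝓝 (x.1 j), setComp x j s ∈ 𝒳 := hx
  simpa using h1.self_of_nhds

/-- Under HONEST, a report is at most `r₀` exactly when the latent value is at most the
threshold. -/
lemma Honest.le_iff_le_threshold {ℋ : Set ℝ} {r : ℝ → 𝒱 → ℝ} (honest : Honest ℋ r) {v : 𝒱}
    {r₀ y : ℝ} (hy : y ∈ ℋ) : r y v ≤ r₀ ↔ (y : EReal) ≤ threshold ℋ r v r₀ := by
  constructor
  · exact fun hle => le_sSup ⟨y, ⟨hy, hle⟩, rfl⟩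
  · intro hle
    by_contra! hlt
    have hbdd : ∀ z ∈ {z ∈ ℋ | r z v ≤ r₀}, z < y := fun z hz => by
      by_contra! hyz
      exact absurd ((honest v).1 hy hz.1 hyz) (not_le.2 (hz.2.trans_lt hlt))
    -- If `r y v` exceeds `r₀`, left-continuity makes reports exceed `r₀` on a left gap of some
    -- length `δ` within `ℋ`, so the supremum is at most `y - δ`. This also covers a `y` that is not
    -- a left limit of `ℋ`.
    have hev : ∀ᶠ z in 𝓝[ℋ ∩ Set.Iio y] y, r₀ < r z v :=
      ((honest v).2 y hy).eventually_const_lt hlt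
    rw [eventually_nhdsWithin_iff] at hev
    obtain ⟨δ, hδ, hball⟩ := Metric.eventually_nhds_iff.1 hev
    have hub : threshold ℋ r v r₀ ≤ ((y - δ : ℝ) : EReal) := by
      refine sSup_le ?_
      rintro _ ⟨z, hz, rfl⟩
      rw [EReal.coe_le_coe_iff]
      by_contra! hzd
      refine absurd hz.2 (not_le.2 (hball ?_ ⟨hz.1, hbdd z hz⟩))
      rw [Real.dist_eq, abs_sub_comm, abs_of_pos (sub_pos.2 (hbdd z hz))]
      linarith
    have := EReal.coe_le_coe_iff.1 (hle.trans hub)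
    linarith

/-- The marginal density cancels against the denominator of the conditional mean. Where it vanishes,
integrability and nonnegativity force `p x v y` to be null, so both sides are `0`. -/
lemma flow_coe {ν : Measure ℝ} {p : Regressor J L → 𝒱 → ℝ → ℝ → ℝ} {x : Regressor J L} {v : 𝒱}
    {y : ℝ} (hp : ∀ d, 0 ≤ p x v y d) (hi : Integrable (p x v y) ν) :
    flow ν p x v (y : EReal) = ∫ d, d * p x v y d ∂ν := by
  rw [flow, if_neg (by simp), EReal.toReal_coe, condEffect, ← integral_const_mul]
  by_cases h0 : condDensity ν p x v y = 0
  · have h1 : p x v y =ᵐ[ν] 0 := (integral_eq_zero_iff_of_nonneg hp hi).1 h0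
    refine integral_congr_ae ?_
    filter_upwards [h1] with d hd
    simp [hd]
  · congr with d
    field_simp

variable [MeasurableSpace 𝒱] [MeasurableSpace 𝒰]

lemma reportCDF_eq_integral (κV : Kernel (Fin L → ℝ) 𝒱) [IsMarkovKernel κV]
    (κU : Kernel ((Fin L → ℝ) × 𝒱) 𝒰) [IsMarkovKernel κU]
    {h : Regressor J L → 𝒰 → ℝ} (hh : Measurable (Function.uncurry h))
    {r : ℝ → 𝒱 → ℝ} (hr : Measurable (Function.uncurry r)) (r₀ : ℝ) (x : Regressor J L) :
    (Measurable fun v => (κU (x.2, v)).real {u | r (h x u) v ≤ r₀}) ∧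
    reportCDF κV κU h r r₀ x = ∫ v, (κU (x.2, v)).real {u | r (h x u) v ≤ r₀} ∂(κV x.2) := by
  have hS : MeasurableSet {q : 𝒱 × 𝒰 | r (h x q.2) q.1 ≤ r₀} :=
    measurableSet_le (hr.comp ((hh.comp (measurable_const.prodMk measurable_snd)).prodMk
      measurable_fst)) measurable_const
  have hm : Measurable fun v => κU (x.2, v) {u | r (h x u) v ≤ r₀} :=
    Kernel.measurable_kernel_prodMk_left (κ := κU.comap (fun v => (x.2, v)) (by fun_prop)) hS
  refine ⟨hm.ennreal_toReal, ?_⟩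
  rw [reportCDF, Measure.real, condLaw, Kernel.compProd_apply hS]
  simp only [Measure.real]
  rw [integral_toReal hm.aemeasurable (Eventually.of_forall fun v => measure_lt_top _ _)]
  rfl

lemma ae_of_ae_condLaw_fst {κV : Kernel (Fin L → ℝ) 𝒱} [IsMarkovKernel κV]
    {κU : Kernel ((Fin L → ℝ) × 𝒱) 𝒰} [IsMarkovKernel κU] {x : Regressor J L} {s : 𝒱 → Prop}
    (hs : ∀ᵐ q ∂(condLaw κV κU x), s q.1) : ∀ᵐ v ∂(κV x.2), s v := by
  have := Kernel.ae_ae_of_ae_compProd hs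
  rw [Kernel.comap_apply] at this
  filter_upwards [this] with v hv
  -- The property does not involve `u`, so one `u` suffices, and the law of `U` is nonzero. No
  -- measurability of `s` is needed.
  exact hv.exists.choose_spec

lemma condLaw_map_fst (κV : Kernel (Fin L → ℝ) 𝒱) [IsMarkovKernel κV]
    (κU : Kernel ((Fin L → ℝ) × 𝒱) 𝒰) [IsMarkovKernel κU] (x : Regressor J L) :
    (condLaw κV κU x).map Prod.fst = κV x.2 := by
  rw [← Kernel.fst_apply, condLaw, Kernel.fst_compProd, Kernel.comap_apply]

/-- The bound `c` is chosen before `x`, `I` and `v`, which makes the Lipschitz constant uniform in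
`v`. -/
lemma Reg.hasJointFlowDensity [MeasurableSpace Ω] {P : Measure Ω} {T : Ω → Fin J → ℝ}
    {κU : Kernel ((Fin L → ℝ) × 𝒱) 𝒰} {h : Regressor J L → 𝒰 → ℝ}
    (hh : Measurable (Function.uncurry h))
    {𝒳 : Set (Regressor J L)} {j : Fin J} {ν : Measure ℝ} {p : Regressor J L → 𝒱 → ℝ → ℝ → ℝ}
    (reg : Reg P T κU h 𝒳 j ν p) :
    ∃ c : ℝ → ℝ, ∀ (x : Regressor J L) (I : Set ℝ), IsOpen I →
      (∀ s ∈ I, setComp x j s ∈ compInterior 𝒳 j) → ∀ v,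
      HasJointFlowDensity (κU (x.2, v)) (fun s => h (setComp x j s)) I ν
        (fun s => p (setComp x j s) v) c := by
  obtain ⟨c, hc, hle⟩ := reg.joint_bound
  refine ⟨c, fun x I hI hx v => ⟨?_, hI, fun t ht u => ?_, fun t ht => ?_, fun t ht => ?_,
    fun t ht => ?_, hc, fun t ht => ?_⟩⟩
  · exact hh.comp (((measurable_setComp x j).comp measurable_fst).prodMk measurable_snd)
  · simpa using reg.differentiable _ (hx t ht) u
  · exact reg.joint_measurable _ (hx t ht) v
  · exact reg.joint_nonneg _ (hx t ht) v
  · exact hle _ (hx t ht) v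
  · have := reg.joint_density _ (hx t ht) v
    simp only [partialX_setComp] at this
    exact this

lemma hasDerivAt_reportCDF {κV : Kernel (Fin L → ℝ) 𝒱} [IsMarkovKernel κV]
    {κU : Kernel ((Fin L → ℝ) × 𝒱) 𝒰} [IsMarkovKernel κU]
    {h : Regressor J L → 𝒰 → ℝ} (hh : Measurable (Function.uncurry h))
    {𝒳 : Set (Regressor J L)} {ℋ : Set ℝ} (hℋ : ∀ x ∈ 𝒳, ∀ u, h x u ∈ ℋ)
    {r : ℝ → 𝒱 → ℝ} (hr : Measurable (Function.uncurry r)) (honest : Honest ℋ r)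
    [MeasurableSpace Ω] {P : Measure Ω} {T : Ω → Fin J → ℝ}
    {j : Fin J} {ν : Measure ℝ} [SigmaFinite ν] {p : Regressor J L → 𝒱 → ℝ → ℝ → ℝ}
    (reg : Reg P T κU h 𝒳 j ν p) {r₀ : ℝ} {x : Regressor J L} (hx : x ∈ compInterior 𝒳 j)
    (hreg : ∀ᵐ q ∂(condLaw κV κU x), ∀ y : ℝ, threshold ℋ r q.1 r₀ = (y : EReal) →
      RegularAt j ν p x q.1 y) :
    Integrable (fun q => flow ν p x q.1 (threshold ℋ r q.1 r₀)) (condLaw κV κU x) ∧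
      HasDerivAt (fun s => reportCDF κV κU h r r₀ (setComp x j s))
        (-∫ q, flow ν p x q.1 (threshold ℋ r q.1 r₀) ∂(condLaw κV κU x)) (x.1 j) := by
  obtain ⟨c, hc⟩ := reg.hasJointFlowDensity hh
  obtain ⟨δ, hδ, hball⟩ := Metric.eventually_nhds_iff_ball.1
    (eventually_setComp_mem_compInterior hx)
  set I := Metric.ball (x.1 j) δ
  have hord : I.OrdConnected := (convex_ball _ _).ordConnected
  have hxI : x.1 j ∈ I := Metric.mem_ball_self hδ
  have hfam := hc x I Metric.isOpen_ball hball
  -- `setComp` leaves the controls `x.2` alone, so only the event moves with `s`.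
  let Φ : ℝ → 𝒱 → ℝ := fun s v => (κU (x.2, v)).real {u | r (h (setComp x j s) u) v ≤ r₀}
  let τ : 𝒱 → EReal := fun v => threshold ℋ r v r₀
  have hΦm : ∀ s, Measurable (Φ s) := fun s =>
    (reportCDF_eq_integral κV κU hh hr r₀ (setComp x j s)).1
  have hcdf : ∀ s, reportCDF κV κU h r r₀ (setComp x j s) = ∫ v, Φ s v ∂(κV x.2) := fun s =>
    (reportCDF_eq_integral κV κU hh hr r₀ (setComp x j s)).2
  have hΦ : ∀ s ∈ I, ∀ v, Φ s v =
      (κU (x.2, v)).real {u | (h (setComp x j s) u : EReal) ≤ τ v} := by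
    intro s hs v
    have : {u | r (h (setComp x j s) u) v ≤ r₀} = {u | (h (setComp x j s) u : EReal) ≤ τ v} :=
      Set.ext fun u => honest.le_iff_le_threshold
        (hℋ _ (mem_of_mem_compInterior (hball s hs)) u)
    simp only [Φ, this]
  have hΦcoe : ∀ v (y : ℝ), τ v = y → Set.EqOn (fun s => Φ s v)
      (fun s => (κU (x.2, v)).real {u | h (setComp x j s) u ≤ y}) I := by
    intro v y hy s hs
    simp only [hΦ s hs v, hy, EReal.coe_le_coe_iff]
  have hΦtop : ∀ v, τ v = ⊤ → Set.EqOn (fun s => Φ s v) (fun _ => 1) I := by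
    intro v hy s hs
    simp [hΦ s hs v, hy]
  have hΦbot : ∀ v, τ v = ⊥ → Set.EqOn (fun s => Φ s v) (fun _ => 0) I := by
    intro v hy s hs
    simp [hΦ s hs v, hy]
  have hlip : ∀ v, LipschitzOnWith (Real.nnabs (∫ d, c d * |d| ∂ν)) (fun s => Φ s v) I := by
    intro v
    have hcongr : ∀ {f f' : ℝ → ℝ} {K : NNReal}, Set.EqOn f f' I → LipschitzOnWith K f' I →
        LipschitzOnWith K f I := fun hff hK a ha b hb => by
      rw [hff ha, hff hb]; exact hK ha hb
    induction hτ : τ v using EReal.rec with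
    | bot => exact hcongr (hΦbot v hτ) (LipschitzWith.const' 0).lipschitzOnWith
    | top => exact hcongr (hΦtop v hτ) (LipschitzWith.const' 1).lipschitzOnWith
    | coe y => exact hcongr (hΦcoe v y hτ) ((hfam v).lipschitzOnWith_cdf hord y)
  have hder : ∀ᵐ v ∂(κV x.2), HasDerivAt (fun s => Φ s v) (-flow ν p x v (τ v)) (x.1 j) := by
    have hnhds : I ∈ 𝓝 (x.1 j) := Metric.ball_mem_nhds _ hδ
    filter_upwards [ae_of_ae_condLaw_fst (s := fun v => ∀ y : ℝ,
      threshold ℋ r v r₀ = (y : EReal) → RegularAt j ν p x v y) hreg] with v hv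
    induction hτ : τ v using EReal.rec with
    | bot =>
      simpa [flow] using (hasDerivAt_const (x.1 j) (0 : ℝ)).congr_of_eventuallyEq
        ((hΦbot v hτ).eventuallyEq_of_mem hnhds)
    | top =>
      simpa [flow] using (hasDerivAt_const (x.1 j) (1 : ℝ)).congr_of_eventuallyEq
        ((hΦtop v hτ).eventuallyEq_of_mem hnhds)
    | coe y =>
      obtain ⟨hi, hcont⟩ := hv y hτ
      rw [flow_coe (reg.joint_nonneg x hx v y) hi]
      have := (hfam v).hasDerivAt_cdf hord (τ := y) hxI hcont
      rw [setComp_self] at this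
      exact this.congr_of_eventuallyEq ((hΦcoe v y hτ).eventuallyEq_of_mem hnhds)
  -- Neither `p` nor the threshold is known to be measurable in `v`; the flow is, up to null sets,
  -- as an a.e. limit of difference quotients of `Φ`.
  have hmeas : AEStronglyMeasurable (fun v => -flow ν p x v (τ v)) (κV x.2) := by
    refine aestronglyMeasurable_of_tendsto_ae (𝓝[≠] (0 : ℝ))
      (f := fun s v => s⁻¹ • (Φ (x.1 j + s) v - Φ (x.1 j) v))
      (fun s => (((hΦm _).sub (hΦm _)).const_smul s⁻¹).aestronglyMeasurable) ?_
    filter_upwards [hder] with v hv using hv.tendsto_slope_zero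
  obtain ⟨hint, hmain⟩ := hasDerivAt_integral_of_dominated_loc_of_lip (𝕜 := ℝ)
    (bound := fun _ => ∫ d, c d * |d| ∂ν) (Metric.ball_mem_nhds (x.1 j) hδ)
    (Eventually.of_forall fun s => (hΦm s).aestronglyMeasurable)
    (Integrable.of_bound (hΦm _).aestronglyMeasurable 1 (Eventually.of_forall fun v => by
      rw [Real.norm_of_nonneg measureReal_nonneg]; exact measureReal_le_one))
    hmeas (Eventually.of_forall hlip) (integrable_const _) hder
  rw [← condLaw_map_fst κV κU x] at hint
  have hint' := (integrable_map_measure hint.1 measurable_fst.aemeasurable).1 hint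
  refine ⟨by simpa [Function.comp_def] using hint'.neg, ?_⟩
  simp only [hcdf]
  rw [← integral_neg, ← integral_map (φ := Prod.fst) (f := fun v => -flow ν p x v (τ v))
    measurable_fst.aemeasurable hint.1, condLaw_map_fst]
  exact hmain

end OrderedResponse

theorem theorem1 {J L : ℕ} {Ω 𝒱 𝒰 : Type*}
    [MeasurableSpace Ω] [StandardBorelSpace Ω]
    [MeasurableSpace 𝒱] [StandardBorelSpace 𝒱] [MeasurableSpace 𝒰] [StandardBorelSpace 𝒰]
    (P : Measure Ω) [IsProbabilityMeasure P]
    -- the observables, the heterogeneity, and the sets of possible values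
    (T : Ω → Fin J → ℝ) (W : Ω → Fin L → ℝ) (V : Ω → 𝒱) (U : Ω → 𝒰) (H R : Ω → ℝ)
    (hT : Measurable T) (hW : Measurable W) (hV : Measurable V) (hU : Measurable U)
    (𝒳 : Set (Regressor J L)) (ℋ ℛ : Set ℝ) (h𝒳 : ∀ᵐ ω ∂P, (T ω, W ω) ∈ 𝒳)
    -- the model `H = h(X, U)`, `R = r(H, V)`
    (h : Regressor J L → 𝒰 → ℝ) (hh : Measurable (Function.uncurry h))
    (hℋ : ∀ x ∈ 𝒳, ∀ u, h x u ∈ ℋ)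
    (r : ℝ → 𝒱 → ℝ) (hr : Measurable (Function.uncurry r))
    (hℛ : ∀ y ∈ ℋ, ∀ v, r y v ∈ ℛ)
    (hH : ∀ ω, H ω = h (T ω, W ω) (U ω)) (hR : ∀ ω, R ω = r (H ω) (V ω))
    -- versions of the conditional laws of `V` given `W` and of `U` given `(W, V)`
    (κV : Kernel (Fin L → ℝ) 𝒱) [IsMarkovKernel κV]
    (κU : Kernel ((Fin L → ℝ) × 𝒱) 𝒰) [IsMarkovKernel κU]
    (hκV : HasCondDistrib V W κV P)
    (hκU : HasCondDistrib U (fun ω => (W ω, V ω)) κU P)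
    -- HONEST, EXOG, and REG for the component `j`
    (honest : Honest ℋ r) (exog : Exog P T W V U hW hV)
    (j : Fin J) (ν : Measure ℝ) [SigmaFinite ν] (p : Regressor J L → 𝒱 → ℝ → ℝ → ℝ)
    (reg : Reg P T κU h 𝒳 j ν p) :
    -- `condLaw κV κU` is the conditional law of `(V, U)` given `X`
    HasCondDistrib (fun ω => (V ω, U ω)) (fun ω => (T ω, W ω)) (condLaw κV κU) P ∧
    ∀ r₀ ∈ ℛ,
      -- `reportCDF` is the conditional probability of `R ≤ r₀` given `X`
      (P⟦{ω | R ω ≤ r₀} | MeasurableSpace.comap (fun ω => (T ω, W ω)) inferInstance⟧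
        =ᵐ[P] fun ω => reportCDF κV κU h r r₀ (T ω, W ω)) ∧
      ∀ x ∈ compInterior 𝒳 j,
        (∀ᵐ q ∂(condLaw κV κU x), ∀ y : ℝ, threshold ℋ r q.1 r₀ = (y : EReal) →
          RegularAt j ν p x q.1 y) →
        Integrable (fun q => flow ν p x q.1 (threshold ℋ r q.1 r₀)) (condLaw κV κU x) ∧
        HasDerivAt (fun s => reportCDF κV κU h r r₀ (setComp x j s))
          (-∫ q, flow ν p x q.1 (threshold ℋ r q.1 r₀) ∂(condLaw κV κU x)) (x.1 j) := by
  have hlaw := hasCondDistrib_condLaw hT hW hV hU κV κU hκV hκU exog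
  refine ⟨hlaw, fun r₀ _ => ⟨?_, fun x hx hreg =>
    hasDerivAt_reportCDF hh hℋ hr honest reg hx hreg⟩⟩
  simp only [hR, hH]
  exact condExp_report_ae_eq (hT.prodMk hW) hV hU κV κU hlaw hh hr r₀
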